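/- Let $G$ be a group with normal subgroups $H$ and $K$ such that $G=HK$ and $[H,K]=1$, and put $A=H\cap K$ (a central subgroup of $G$) and $Z=H'\cap K'$, where $X'$ denotes the commutator subgroup of $X$. Let $D$ be a divisible abelian group, regarded as a trivial module over every group in question. For groups $P,Q$ write $P\otimes Q$ for $P/P'\otimes_{\mathbb Z} Q/Q'$. Let $$\theta'=(\operatorname{res}^G_H,\operatorname{res}^G_K,\nu): H^2(G,D)\to H^2(H,D)\oplus H^2(K,D)\oplus \operatorname{Hom}(H\otimes K,D),$$ where $\nu(\xi)(hH'\otimes kK')=f(h,k)-f(k,h)$ for any $2$-cocycle $f$ representing $\xi$, and let $$\theta: H^2(G/A,D)\to H^2(H/A,D)\oplus H^2(K/A,D)\oplus \operatorname{Hom}(H/A\otimes K/A,D)$$ be defined in the same way from $G/A$, $H/A$, $K/A$. For a central subgroup $N$ of a group $X$ let $\operatorname{tra}:\operatorname{Hom}(N\cap X',D)\to H^2(X/N,D)$ be the transgression: $\operatorname{tra}(g)$ is the class of the cocycle $(x,y)\mapsto \tilde g\big(s(x)s(y)s(xy)^{-1}\big)$, where $\tilde g: N\to D$ is a homomorphism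 extending $g$ and $s$ is a section of $X\to X/N$; the class does not depend on $\tilde g$ and $s$. Then $\theta$ is an isomorphism, and there is a well-defined homomorphism $\chi:\operatorname{Hom}(Z,D)\to H^2(G,D)$ given by $$\chi(f)=\inf\big(\theta^{-1}(\operatorname{tra}(g_1),\operatorname{tra}(g_2),0)\big),$$ where $g_1\in\operatorname{Hom}(A\cap H',D)$ and $g_2\in\operatorname{Hom}(A\cap K',D)$ are any homomorphisms with $g_1|_Z-g_2|_Z=f$ (such $g_1,g_2$ exist for every $f$), and $\inf: H^2(G/A,D)\to H^2(G,D)$ is inflation. The sequence $$0\to\operatorname{Hom}(Z,D)\xrightarrow{\ \chi\ }H^2(G,D)\xrightarrow{\ \theta'\ }H^2(H,D)\oplus H^2(K,D)\oplus\operatorname{Hom}(H\otimes K,D)$$ is exact. Consequently, if $Z=1$ then $\theta'$ is injective. -/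

import Mathlib

open scoped TensorProduct

universe u

namespace CentralProduct

noncomputable section

/-! ### Second cohomology with trivial coefficients -/

/-- The `2`-cocycles of `X` with values in the trivial `X`-module `D`. (The base ring is `ℤ`, lifted
to the universe of `X`, so a module over it is just an abelian group.) -/
abbrev Z2 (X D : Type u) [Group X] [AddCommGroup D] : Type u :=
  groupCohomology.cocycles₂ (Rep.trivial (ULift.{u} ℤ) X D)

/-- The second cohomology group `H²(X, D)` of `X` with values in the trivial `X`-module `D`. -/
abbrev H2 (X D : Type u) [Group X] [AddCommGroup D] : Type u :=
  groupCohomology.H2 (Rep.trivial (ULift.{u} ℤ) X D)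

section basic

variable {X Y D : Type u} [Group X] [Group Y] [AddCommGroup D]

/-- The value in `D` of a `2`-cocycle at a pair of elements. -/
def val (f : Z2 X D) (x y : X) : D := f.1 (x, y)

lemma val_add (f g : Z2 X D) (x y : X) : val (f + g) x y = val f x y + val g x y := rfl

lemma val_cocycle (f : Z2 X D) (x y z : X) :
    val f (x * y) z + val f x y = val f y z + val f x (y * z) :=
  (groupCohomology.mem_cocycles₂_iff f.1).1 f.2 x y z

lemma val_one_left (f : Z2 X D) (x : X) : val f 1 x = val f 1 1 := by
  have h := val_cocycle f 1 1 x
  simp only [one_mul] at h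
  exact (add_left_cancel h).symm

lemma val_one_right (f : Z2 X D) (x : X) : val f x 1 = val f 1 1 := by
  have h := val_cocycle f x 1 1
  simp only [mul_one] at h
  exact add_right_cancel h

/-- A function satisfying the cocycle identity, as a `2`-cocycle. -/
def mkZ2 (f : X → X → D)
    (hf : ∀ x y z, f (x * y) z + f x y = f y z + f x (y * z)) : Z2 X D :=
  ⟨fun p => f p.1 p.2, (groupCohomology.mem_cocycles₂_iff _).2 hf⟩

lemma val_mkZ2 (f : X → X → D) (hf) (x y : X) : val (mkZ2 f hf) x y = f x y := rfl

/-- The projection sending a `2`-cocycle to its cohomology class. -/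
def cls (X D : Type u) [Group X] [AddCommGroup D] : Z2 X D →+ H2 X D :=
  (groupCohomology.H2π (Rep.trivial (ULift.{u} ℤ) X D)).hom.toAddMonoidHom

lemma cls_surjective : Function.Surjective (cls X D) := fun x => by
  induction x using groupCohomology.H2_induction_on with
  | h x => exact ⟨x, rfl⟩

lemma cls_eq_zero_iff (f : Z2 X D) :
    cls X D f = 0 ↔ ∃ c : X → D, ∀ x y, val f x y = c y - c (x * y) + c x := by
  refine (groupCohomology.H2π_eq_zero_iff f).trans ⟨?_, ?_⟩
  · rintro ⟨c, hc⟩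
    exact ⟨c, fun x y => (congrFun hc (x, y)).symm⟩
  · rintro ⟨c, hc⟩
    exact ⟨c, funext fun p => (hc p.1 p.2).symm⟩

/-- The homomorphism `H²(Y, D) → H²(X, D)` induced by a group homomorphism `φ : X → Y`: restriction
when `φ` is an inclusion, inflation when `φ` is a quotient map. -/
def pullback (D : Type u) [AddCommGroup D] (φ : X →* Y) : H2 Y D →+ H2 X D :=
  (groupCohomology.map (A := Rep.trivial (ULift.{u} ℤ) Y D)
    (B := Rep.trivial (ULift.{u} ℤ) X D) φ (Rep.ofHom ⟨LinearMap.id, fun _ => rfl⟩)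
    2).hom.toAddMonoidHom

/-- Pulling back a cocycle along a homomorphism. -/
def pullbackZ2 (φ : X →* Y) (f : Z2 Y D) : Z2 X D :=
  mkZ2 (fun x y => val f (φ x) (φ y)) fun x y z => by
    simpa using val_cocycle f (φ x) (φ y) (φ z)

lemma pullback_cls (φ : X →* Y) (f : Z2 Y D) :
    pullback D φ (cls Y D f) = cls X D (pullbackZ2 φ f) :=
  groupCohomology.H2π_comp_map_apply (A := Rep.trivial (ULift.{u} ℤ) Y D)
    (B := Rep.trivial (ULift.{u} ℤ) X D) φ (Rep.ofHom ⟨LinearMap.id, fun _ => rfl⟩) f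

end basic

/-! ### The pairing of two commuting homomorphisms -/

section pairing

variable {P Q X D : Type u} [Group P] [Group Q] [Group X] [AddCommGroup D]
  (φ : P →* X) (ψ : Q →* X) (hc : ∀ p q, Commute (φ p) (ψ q))

/-- The abelian tensor product `P/P' ⊗ Q/Q'` of two groups, as an additive group. -/
abbrev AbTensor (P Q : Type u) [Group P] [Group Q] : Type u :=
  Additive (Abelianization P) ⊗[ℤ] Additive (Abelianization Q)

lemma abTensor_hom_ext {F F' : AbTensor P Q →+ D}
    (h : ∀ (p : P) (q : Q),
      F (Additive.ofMul (Abelianization.of p) ⊗ₜ Additive.ofMul (Abelianization.of q))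
        = F' (Additive.ofMul (Abelianization.of p) ⊗ₜ Additive.ofMul (Abelianization.of q))) :
    F = F' := by
  ext t
  induction t using TensorProduct.induction_on with
  | zero => simp
  | add x y hx hy => rw [map_add, map_add, hx, hy]
  | tmul m n =>
    obtain ⟨p, hp⟩ := QuotientGroup.mk_surjective m.toMul
    obtain ⟨q, hq⟩ := QuotientGroup.mk_surjective n.toMul
    have h' := h p q
    have hp' : Additive.ofMul (Abelianization.of p) = m := congrArg Additive.ofMul hp
    have hq' : Additive.ofMul (Abelianization.of q) = n := congrArg Additive.ofMul hq
    rwa [hp', hq'] at h'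

lemma comm_mul_left (f : Z2 X D) {a b c : X} (hac : Commute a c) (hbc : Commute b c) :
    val f (a * b) c - val f c (a * b)
      = (val f a c - val f c a) + (val f b c - val f c b) := by
  have h1 := val_cocycle f a b c
  have h2 := val_cocycle f a c b
  have h3 := val_cocycle f c a b
  rw [hac.eq] at h2
  rw [hbc.eq] at h1
  have e1 := eq_sub_of_add_eq h1
  have e3 : val f c (a * b) = val f (c * a) b + val f c a - val f a b := by rw [h3]; abel
  have e2 : val f (c * a) b = val f c b + val f a (c * b) - val f a c := by rw [← h2]; abel
  rw [e1, e3, e2]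
  abel

lemma comm_mul_right (f : Z2 X D) {a b c : X} (hab : Commute a b) (hac : Commute a c) :
    val f a (b * c) - val f (b * c) a
      = (val f a b - val f b a) + (val f a c - val f c a) := by
  have h := comm_mul_left f hab.symm hac.symm
  rw [← neg_sub, h]
  abel

/-- For a fixed `p`, the homomorphism `Q/Q' → D`, `q ↦ f(p,q) - f(q,p)`. -/
def pairRight (f : Z2 X D) (p : P) : Additive (Abelianization Q) →+ D :=
  MonoidHom.toAdditiveLeft (Abelianization.lift
    (MonoidHom.mk' (fun q : Q => Multiplicative.ofAdd
      (val f (φ p) (ψ q) - val f (ψ q) (φ p))) fun q q' => by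
        rw [← ofAdd_add, map_mul, comm_mul_right f (hc p q) (hc p q')]))

/-- The biadditive map `P/P' × Q/Q' → D`, `(p, q) ↦ f(p,q) - f(q,p)`. -/
def pairBi (f : Z2 X D) : Additive (Abelianization P) →+ Additive (Abelianization Q) →+ D :=
  MonoidHom.toAdditiveLeft (Abelianization.lift
    (MonoidHom.mk' (fun p : P => Multiplicative.ofAdd (pairRight φ ψ hc f p)) fun p p' => by
      rw [← ofAdd_add]
      congr 1
      ext q
      change val f (φ (p * p')) (ψ q) - val f (ψ q) (φ (p * p')) = _
      rw [map_mul, comm_mul_left f (hc p q) (hc p' q)]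
      rfl))

/-- The homomorphism `P ⊗ Q → D` attached to a cocycle `f` of `X`. -/
def nuZ2 : Z2 X D →+ (AbTensor P Q →+ D) :=
  AddMonoidHom.mk' (fun f => TensorProduct.liftAddHom (pairBi φ ψ hc f)
    fun r m n => by rw [map_zsmul, map_zsmul, AddMonoidHom.zsmul_apply]) fun f g => by
      refine abTensor_hom_ext fun p q => ?_
      exact add_sub_add_comm _ _ _ _

lemma nuZ2_tmul (f : Z2 X D) (p : P) (q : Q) :
    nuZ2 φ ψ hc f (Additive.ofMul (Abelianization.of p) ⊗ₜ Additive.ofMul (Abelianization.of q))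
      = val f (φ p) (ψ q) - val f (ψ q) (φ p) := rfl

lemma ker_cls_le_ker_nuZ2 : (cls X D).ker ≤ (nuZ2 φ ψ hc (D := D)).ker := by
  intro f hf
  obtain ⟨c, hc'⟩ := (cls_eq_zero_iff f).1 hf
  rw [AddMonoidHom.mem_ker]
  refine abTensor_hom_ext fun p q => ?_
  change val f (φ p) (ψ q) - val f (ψ q) (φ p) = 0
  rw [hc', hc', (hc p q).eq]
  abel

/-- The homomorphism `ν : H²(X, D) → Hom(P ⊗ Q, D)`; on the class of `f` it is given by
`p ⊗ q ↦ f(p,q) - f(q,p)`. -/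
def nu : H2 X D →+ (AbTensor P Q →+ D) :=
  AddMonoidHom.liftOfSurjective (cls X D) cls_surjective
    ⟨nuZ2 φ ψ hc, ker_cls_le_ker_nuZ2 φ ψ hc⟩

lemma nu_cls_tmul (f : Z2 X D) (p : P) (q : Q) :
    nu φ ψ hc (cls X D f)
        (Additive.ofMul (Abelianization.of p) ⊗ₜ Additive.ofMul (Abelianization.of q))
      = val f (φ p) (ψ q) - val f (ψ q) (φ p) := by
  rw [nu, AddMonoidHom.liftOfSurjective]
  erw [AddMonoidHom.liftOfRightInverse_comp_apply]
  rfl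

/-- The homomorphism `(res, res, ν) : H²(X, D) → H²(P, D) ⊕ H²(Q, D) ⊕ Hom(P ⊗ Q, D)` attached to
two groups `P`, `Q` mapping to commuting subgroups of `X`. -/
def theta (D : Type u) [AddCommGroup D] :
    H2 X D →+ H2 P D × H2 Q D × (AbTensor P Q →+ D) :=
  (pullback D φ).prod ((pullback D ψ).prod (nu φ ψ hc))

end pairing

/-! ### Transgression -/

section transgression

variable {X D : Type u} [Group X] [AddCommGroup D] (N : Subgroup X) [N.Normal]

/-- The element `s(x) s(y) s(xy)⁻¹` of `N`, for the section `s` of `X → X/N` given by choosing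
representatives. -/
def factorSet (x y : X ⧸ N) : N :=
  ⟨x.out * y.out * (x * y).out⁻¹, by
    rw [← QuotientGroup.eq_one_iff]; simp⟩

lemma factorSet_cocycle (hN : N ≤ Subgroup.center X) (x y z : X ⧸ N) :
    factorSet N (x * y) z * factorSet N x y = factorSet N y z * factorSet N x (y * z) := by
  have hc : ∀ (n : N) (a : X), a * n = n * a := fun n a => Subgroup.mem_center_iff.1 (hN n.2) a
  have key : ∀ a b : X ⧸ N, a.out * b.out = factorSet N a b * (a * b).out := fun a b => by
    simp [factorSet]
  apply Subtype.ext
  apply mul_right_cancel (b := (x * y * z).out)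
  have h1 : x.out * y.out * z.out
      = (factorSet N (x * y) z * factorSet N x y : X) * (x * y * z).out := by
    rw [key x y, mul_assoc, key (x * y) z, ← mul_assoc, hc]
  have h2 : x.out * (y.out * z.out)
      = (factorSet N y z * factorSet N x (y * z) : X) * (x * y * z).out := by
    rw [key y z, ← mul_assoc, hc, mul_assoc, key x (y * z), ← mul_assoc, mul_assoc x y z]
  exact h1.symm.trans ((mul_assoc _ _ _).trans h2)

/-- The transgression `Hom(N, D) → H²(X/N, D)` of a central subgroup `N` of `X`; it sends `F` to the
class of the cocycle `F(s(x) s(y) s(xy)⁻¹)`. -/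
def traFull (hN : N ≤ Subgroup.center X) : (Additive N →+ D) →+ H2 (X ⧸ N) D :=
  (cls (X ⧸ N) D).comp (AddMonoidHom.mk' (fun F =>
    mkZ2 (fun x y => F (Additive.ofMul (factorSet N x y))) fun x y z => by
      simp only [← map_add, ← ofMul_mul, factorSet_cocycle N hN])
    fun _ _ => rfl)

/-- Restriction `Hom(T, D) → Hom(S, D)` for subgroups `S ≤ T`. -/
def resHom (D : Type u) [AddCommGroup D] {S T : Subgroup X} (h : S ≤ T) :
    (Additive T →+ D) →+ (Additive S →+ D) :=
  AddMonoidHom.mk' (fun F => F.comp (MonoidHom.toAdditive (Subgroup.inclusion h))) fun _ _ => rfl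

lemma resHom_surjective [DivisibleBy D ℤ] (hN : N ≤ Subgroup.center X) :
    Function.Surjective (resHom D (inf_le_left : N ⊓ commutator X ≤ N)) := by
  intro g
  let _ : CommGroup N := { (inferInstance : Group N) with
    mul_comm := fun a b => Subtype.ext (Subgroup.mem_center_iff.1 (hN b.2) a) }
  let _ : CommGroup ↥(N ⊓ commutator X) := { (inferInstance : Group ↥(N ⊓ commutator X)) with
    mul_comm := fun a b => Subtype.ext (Subgroup.mem_center_iff.1 (hN b.2.1) a) }
  obtain ⟨F, hF⟩ := Module.Baer.extension_property_addMonoidHom (Module.Baer.of_divisible D)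
    (MonoidHom.toAdditive (Subgroup.inclusion
      (inf_le_left : N ⊓ commutator X ≤ N))) (Subgroup.inclusion_injective inf_le_left) g
  exact ⟨F, hF⟩

lemma ker_resHom_le_ker_traFull [DivisibleBy D ℤ] (hN : N ≤ Subgroup.center X) :
    (resHom D (inf_le_left : N ⊓ commutator X ≤ N)).ker ≤ (traFull N hN (D := D)).ker := by
  intro F hF
  let j : Additive N →+ Additive (Abelianization X) :=
    MonoidHom.toAdditive (Abelianization.of.comp N.subtype)
  have hj : ∀ n : N, j (Additive.ofMul n) = 0 → F (Additive.ofMul n) = 0 := fun n hn => by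
    have hn' : (n : X) ∈ commutator X := (QuotientGroup.eq_one_iff (n : X)).1 hn
    exact DFunLike.congr_fun hF (Additive.ofMul (⟨n, n.2, hn'⟩ : ↥(N ⊓ commutator X)))
  let F' : j.range →+ D := AddMonoidHom.liftOfSurjective j.rangeRestrict
    j.rangeRestrict_surjective ⟨F, fun n hn => hj n (congrArg Subtype.val hn)⟩
  have hF' : ∀ n, F' (j.rangeRestrict n) = F n := fun n =>
    AddMonoidHom.liftOfRightInverse_comp_apply _ _ _ _ n
  obtain ⟨E, hE⟩ := Module.Baer.extension_property_addMonoidHom (Module.Baer.of_divisible D)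
    j.range.subtype Subtype.val_injective F'
  have hEF : ∀ n : N, E (Additive.ofMul (Abelianization.of (n : X))) = F (Additive.ofMul n) :=
    fun n => (DFunLike.congr_fun hE (j.rangeRestrict (Additive.ofMul n))).trans (hF' _)
  refine (cls_eq_zero_iff _).2 ⟨fun x => E (Additive.ofMul (Abelianization.of x.out)), ?_⟩
  intro x y
  change F (Additive.ofMul (factorSet N x y)) = _
  rw [← hEF]
  simp only [factorSet, map_mul, map_inv, ofMul_mul, ofMul_inv, map_add, map_neg]
  abel

/-- The transgression `tra : Hom(N ∩ X', D) → H²(X/N, D)` of a central subgroup `N` of `X`, for a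
divisible group `D`: extend a homomorphism from `N ∩ X'` to `N` and apply `traFull`. -/
def tra (D : Type u) [AddCommGroup D] [DivisibleBy D ℤ] (hN : N ≤ Subgroup.center X) :
    (Additive ↥(N ⊓ commutator X) →+ D) →+ H2 (X ⧸ N) D :=
  AddMonoidHom.liftOfSurjective (resHom D inf_le_left) (resHom_surjective N hN)
    ⟨traFull N hN, ker_resHom_le_ker_traFull N hN⟩

lemma tra_resHom [DivisibleBy D ℤ] (hN : N ≤ Subgroup.center X) (F : Additive N →+ D) :
    tra N D hN (resHom D inf_le_left F) = traFull N hN F := by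
  exact AddMonoidHom.liftOfRightInverse_comp_apply _ _ _ _ F

end transgression

/-! ### The maps attached to a central product `G = HK`, with `A = H ∩ K` and `Z = H' ∩ K'` -/

section product

variable {G : Type u} [Group G] (H K : Subgroup G)

lemma commute_of_commutator_eq_bot {H K : Subgroup G} (hcomm : ⁅H, K⁆ = ⊥) (h : H) (k : K) :
    Commute (h : G) (k : G) :=
  (Subgroup.mem_centralizer_iff.1
    (Subgroup.commutator_eq_bot_iff_le_centralizer.1 hcomm h.2) k k.2).symm

lemma amalgam_le_center_left {H K : Subgroup G} (hcomm : ⁅H, K⁆ = ⊥) :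
    (H ⊓ K).subgroupOf H ≤ Subgroup.center H := fun a ha =>
  Subgroup.mem_center_iff.2 fun h =>
    Subtype.ext (commute_of_commutator_eq_bot hcomm h ⟨a, (Subgroup.mem_subgroupOf.1 ha).2⟩)

lemma amalgam_le_center_right {H K : Subgroup G} (hcomm : ⁅H, K⁆ = ⊥) :
    (H ⊓ K).subgroupOf K ≤ Subgroup.center K := fun a ha =>
  Subgroup.mem_center_iff.2 fun k =>
    Subtype.ext
      (commute_of_commutator_eq_bot hcomm ⟨a, (Subgroup.mem_subgroupOf.1 ha).1⟩ k).symm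

/-- `θ' = (res, res, ν) : H²(G, D) → H²(H, D) ⊕ H²(K, D) ⊕ Hom(H ⊗ K, D)`. -/
def thetaPrime (D : Type u) [AddCommGroup D] {H K : Subgroup G} (hcomm : ⁅H, K⁆ = ⊥) :
    H2 G D →+ H2 H D × H2 K D × (AbTensor H K →+ D) :=
  theta H.subtype K.subtype (commute_of_commutator_eq_bot hcomm) D

/-- The natural injection `H/A → G/A`. -/
def quotLeft [H.Normal] [K.Normal] : H ⧸ (H ⊓ K).subgroupOf H →* G ⧸ (H ⊓ K) :=
  QuotientGroup.map _ _ H.subtype le_rfl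

/-- The natural injection `K/A → G/A`. -/
def quotRight [H.Normal] [K.Normal] : K ⧸ (H ⊓ K).subgroupOf K →* G ⧸ (H ⊓ K) :=
  QuotientGroup.map _ _ K.subtype le_rfl

lemma quot_commute {H K : Subgroup G} [H.Normal] [K.Normal] (hcomm : ⁅H, K⁆ = ⊥)
    (x : H ⧸ (H ⊓ K).subgroupOf H) (y : K ⧸ (H ⊓ K).subgroupOf K) :
    Commute (quotLeft H K x) (quotRight H K y) := by
  obtain ⟨h, rfl⟩ := QuotientGroup.mk_surjective x
  obtain ⟨k, rfl⟩ := QuotientGroup.mk_surjective y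
  exact (commute_of_commutator_eq_bot hcomm h k).map (QuotientGroup.mk' (H ⊓ K))

/-- `θ = (res, res, ν) : H²(G/A, D) → H²(H/A, D) ⊕ H²(K/A, D) ⊕ Hom(H/A ⊗ K/A, D)`. -/
def thetaBar (D : Type u) [AddCommGroup D] {H K : Subgroup G} [H.Normal] [K.Normal]
    (hcomm : ⁅H, K⁆ = ⊥) :
    H2 (G ⧸ (H ⊓ K)) D →+ H2 (H ⧸ (H ⊓ K).subgroupOf H) D × H2 (K ⧸ (H ⊓ K).subgroupOf K) D ×
      (AbTensor (H ⧸ (H ⊓ K).subgroupOf H) (K ⧸ (H ⊓ K).subgroupOf K) →+ D) :=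
  theta (quotLeft H K) (quotRight H K) (quot_commute hcomm) D

lemma mk_mem_commutator {H : Subgroup G} {z : G} (hz : z ∈ ⁅H, H⁆) (hzH : z ∈ H) :
    (⟨z, hzH⟩ : H) ∈ commutator H := by
  rw [← Subgroup.map_subtype_commutator] at hz
  obtain ⟨w, hw, rfl⟩ := hz
  exact hw

/-- The inclusion `Z → A ∩ H'`, where the target is viewed as a subgroup of `H`. -/
def inclLeft : ↥(⁅H, H⁆ ⊓ ⁅K, K⁆) →* ↥((H ⊓ K).subgroupOf H ⊓ commutator H) :=
  MonoidHom.mk' (fun z =>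
    have hH := H.commutator_le_self z.2.1
    ⟨⟨z, hH⟩, ⟨hH, K.commutator_le_self z.2.2⟩, mk_mem_commutator z.2.1 hH⟩) fun _ _ => rfl

/-- The inclusion `Z → A ∩ K'`, where the target is viewed as a subgroup of `K`. -/
def inclRight : ↥(⁅H, H⁆ ⊓ ⁅K, K⁆) →* ↥((H ⊓ K).subgroupOf K ⊓ commutator K) :=
  MonoidHom.mk' (fun z =>
    have hK := K.commutator_le_self z.2.2
    ⟨⟨z, hK⟩, ⟨H.commutator_le_self z.2.1, hK⟩, mk_mem_commutator z.2.2 hK⟩) fun _ _ => rfl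

/-- The homomorphism `α₁* : Hom(A ∩ H', D) ⊕ Hom(A ∩ K', D) → Hom(Z, D)` induced by
`α₁ : Z → (A ∩ H') ⊕ (A ∩ K')`, `z ↦ (z, z⁻¹)`; thus `α₁*(g₁, g₂) = g₁|_Z - g₂|_Z`. -/
def alphaStar {D : Type u} [AddCommGroup D]
    (g₁ : Additive ↥((H ⊓ K).subgroupOf H ⊓ commutator H) →+ D)
    (g₂ : Additive ↥((H ⊓ K).subgroupOf K ⊓ commutator K) →+ D) :
    Additive ↥(⁅H, H⁆ ⊓ ⁅K, K⁆) →+ D :=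
  g₁.comp (MonoidHom.toAdditive (inclLeft H K)) - g₂.comp (MonoidHom.toAdditive (inclRight H K))

/-- The defining property of the value `ξ = χ(f)`: it is `inf (θ⁻¹ (tra g₁, tra g₂, 0))` for some
`(g₁, g₂)` with `α₁*(g₁, g₂) = f`. -/
def IsChiValue {D : Type u} [AddCommGroup D] [DivisibleBy D ℤ] {H K : Subgroup G} [H.Normal]
    [K.Normal] (hcomm : ⁅H, K⁆ = ⊥) (f : Additive ↥(⁅H, H⁆ ⊓ ⁅K, K⁆) →+ D) (ξ : H2 G D) : Prop :=
  ∃ (g₁ : Additive ↥((H ⊓ K).subgroupOf H ⊓ commutator H) →+ D)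
    (g₂ : Additive ↥((H ⊓ K).subgroupOf K ⊓ commutator K) →+ D) (η : H2 (G ⧸ (H ⊓ K)) D),
    alphaStar H K g₁ g₂ = f ∧
    thetaBar D hcomm η = (tra _ D (amalgam_le_center_left hcomm) g₁,
      tra _ D (amalgam_le_center_right hcomm) g₂, 0) ∧
    pullback D (QuotientGroup.mk' (H ⊓ K)) η = ξ

end product

end

end CentralProduct

namespace CentralProduct

noncomputable section

/-! ### The extension attached to a cocycle -/

section extension

variable {X P Q D : Type u} [Group X] [Group P] [Group Q] [AddCommGroup D]

/-! Everything rests on one gluing principle, `cls_eq_zero_of_glue`. A primitive of `f` on a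
subgroup is the same thing as a lift of that subgroup to the extension of `X` by `D` defined by `f`.
Lifts of two commuting subgroups that generate `X` combine into a splitting when they commute, which
is the symmetry of `f` between the subgroups, and when they agree on the intersection.

For `G/A`, the direct product of `H/A` and `K/A`, the intersection is trivial, so gluing makes `θ`
injective; an explicit cocycle makes it surjective. For `G` itself, a class in `ker θ'` has
primitives `a` on `H` and `b` on `K` whose difference on `A` is a homomorphism `F`. This mismatch is
the only obstruction, and subtracting the inflation of `θ⁻¹(tra F, 0, 0)` removes it. Hence `ker θ'`
is the image of `χ`; conversely transgressions die under inflation, so `θ'χ = 0`.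

That `χ` is well defined and injective comes from the kernel of inflation `H²(G/A) → H²(G)`, which
consists of the transgressions of homomorphisms `F : A → D`. Under `θ` these become `(tra F|, tra
F|, 0)`. Since `D` is divisible, a pair `(g₁, g₂)` consists of restrictions of a single `F` exactly
when `g₁` and `g₂` agree on `Z`. -/

/-- The central extension of `X` by `D` with factor set `f`. -/
@[ext]
structure Ext (f : Z2 X D) : Type u where
  /-- The `D`-coordinate. -/
  fst : D
  /-- The image in `X`. -/
  snd : X

namespace Ext

variable (f : Z2 X D)

instance : Mul (Ext f) := ⟨fun a b => ⟨a.fst + b.fst + val f a.snd b.snd, a.snd * b.snd⟩⟩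

-- Cocycles are not normalised, so the identity carries the correction `-f(1,1)`.
instance : One (Ext f) := ⟨⟨-val f 1 1, 1⟩⟩

instance : Inv (Ext f) := ⟨fun a => ⟨-a.fst - val f a.snd⁻¹ a.snd - val f 1 1, a.snd⁻¹⟩⟩

variable {f}

@[simp] lemma mul_fst (a b : Ext f) : (a * b).fst = a.fst + b.fst + val f a.snd b.snd := rfl
@[simp] lemma mul_snd (a b : Ext f) : (a * b).snd = a.snd * b.snd := rfl
@[simp] lemma one_fst : (1 : Ext f).fst = -val f 1 1 := rfl
@[simp] lemma one_snd : (1 : Ext f).snd = 1 := rfl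
@[simp] lemma inv_fst (a : Ext f) :
    a⁻¹.fst = -a.fst - val f a.snd⁻¹ a.snd - val f 1 1 := rfl
@[simp] lemma inv_snd (a : Ext f) : a⁻¹.snd = a.snd⁻¹ := rfl

instance : Group (Ext f) := Group.ofLeftAxioms
  (fun a b c => Ext.ext (by
    have h := eq_sub_of_add_eq (val_cocycle f a.snd b.snd c.snd)
    simp only [mul_fst, mul_snd, h]
    abel) (mul_assoc _ _ _))
  (fun a => Ext.ext (by simp [val_one_left f a.snd]) (one_mul _))
  (fun a => Ext.ext (by
    simp only [mul_fst, inv_fst, inv_snd, one_fst]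
    abel) (inv_mul_cancel _))

/-- A homomorphism to `X` along which `f` becomes the coboundary of `a` lifts to the extension. -/
def lift (φ : P →* X) (a : P → D)
    (ha : ∀ p p', val f (φ p) (φ p') = a p' - a (p * p') + a p) : P →* Ext f :=
  -- With this sign, adding `f(φ p, φ p')` to `-a p - a p'` leaves exactly `-a (p * p')`.
  MonoidHom.mk' (fun p => ⟨-a p, φ p⟩) fun p p' => Ext.ext (by
    simp only [mul_fst, ha]
    abel) (map_mul φ p p')

end Ext

/-- A cocycle whose extension has a homomorphic section is a coboundary. -/
lemma cls_eq_zero_of_section (f : Z2 X D) (σ : X →* Ext f) (hσ : ∀ x, (σ x).snd = x) :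
    cls X D f = 0 := by
  refine (cls_eq_zero_iff f).2 ⟨fun x => -(σ x).fst, fun x y => ?_⟩
  simp only [map_mul, Ext.mul_fst, hσ]
  abel

/-- A cocycle that is a coboundary on two commuting groups generating `X`, with primitives that
agree on the common part, and that is symmetric between the two groups, is a coboundary. -/
lemma cls_eq_zero_of_glue (f : Z2 X D) (φ : P →* X) (ψ : Q →* X)
    (hc : ∀ p q, Commute (φ p) (ψ q)) (hsurj : ∀ x, ∃ p q, φ p * ψ q = x) (a : P → D) (b : Q → D)
    (ha : ∀ p p', val f (φ p) (φ p') = a p' - a (p * p') + a p)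
    (hb : ∀ q q', val f (ψ q) (ψ q') = b q' - b (q * q') + b q)
    (hf : ∀ p q, val f (φ p) (ψ q) = val f (ψ q) (φ p))
    (hab : ∀ p q, φ p = ψ q → a p = b q) : cls X D f = 0 := by
  let s := Ext.lift φ a ha
  let t := Ext.lift ψ b hb
  have hst : ∀ p q, Commute (s p) (t q) := fun p q => Ext.ext (by
    change -a p + -b q + val f (φ p) (ψ q) = -b q + -a p + val f (ψ q) (φ p)
    rw [hf, add_comm (-a p)]) (hc p q).eq
  let S := MonoidHom.noncommCoprod s t hst
  let π := MonoidHom.noncommCoprod φ ψ hc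
  have hπ : Function.Surjective π := fun x => by
    obtain ⟨p, q, h⟩ := hsurj x
    exact ⟨(p, q), h⟩
  -- An element `(p, q)` of the kernel has `φ p = ψ q⁻¹`, a common point, where the two lifts
  -- coincide.
  have hker : π.ker ≤ S.ker := by
    rintro ⟨p, q⟩ h
    have h' : φ p * ψ q = 1 := h
    have hp : φ p = ψ q⁻¹ := by rw [map_inv]; exact eq_inv_of_mul_eq_one_left h'
    have hs : s p = t q⁻¹ := Ext.ext (congrArg Neg.neg (hab _ _ hp)) hp
    change s p * t q = 1
    rw [hs, map_inv, inv_mul_cancel]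
  let σ : X →* Ext f := MonoidHom.liftOfSurjective π hπ ⟨S, hker⟩
  have hσ : ∀ y, σ (π y) = S y := fun y => MonoidHom.liftOfRightInverse_comp_apply _ _ _ _ y
  refine cls_eq_zero_of_section f σ fun x => ?_
  obtain ⟨y, rfl⟩ := hπ x
  rw [hσ]
  rfl

end extension

/-! ### The map `θ` for a direct product -/

section directProduct

variable {X P Q D : Type u} [Group X] [Group P] [Group Q] [AddCommGroup D]

lemma pullback_pullback {W : Type u} [Group W] (φ : P →* X) (ψ : X →* W) (η : H2 W D) :
    pullback D φ (pullback D ψ η) = pullback D (ψ.comp φ) η := by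
  obtain ⟨f, rfl⟩ := cls_surjective η
  simp only [pullback_cls]
  rfl

lemma cls_eq_cls_iff (f g : Z2 X D) :
    cls X D f = cls X D g ↔ ∃ c : X → D, ∀ x y, val f x y = val g x y + (c y - c (x * y) + c x) := by
  rw [← sub_eq_zero, ← map_sub, cls_eq_zero_iff]
  exact exists_congr fun c => forall₂_congr fun x y =>
    sub_eq_iff_eq_add' (a := val f x y) (b := val g x y)

/-- The components of a vanishing value of `theta`, in terms of cocycles. -/
lemma theta_cls_eq_zero {φ : P →* X} {ψ : Q →* X} {hc : ∀ p q, Commute (φ p) (ψ q)} {f : Z2 X D}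
    (h : theta φ ψ hc D (cls X D f) = 0) :
    (∃ a : P → D, ∀ p p', val f (φ p) (φ p') = a p' - a (p * p') + a p) ∧
    (∃ b : Q → D, ∀ q q', val f (ψ q) (ψ q') = b q' - b (q * q') + b q) ∧
    ∀ p q, val f (φ p) (ψ q) = val f (ψ q) (φ p) := by
  have h1 : pullback D φ (cls X D f) = 0 := congrArg Prod.fst h
  have h2 : pullback D ψ (cls X D f) = 0 := congrArg (fun t => t.2.1) h
  have h3 : nu φ ψ hc (cls X D f) = 0 := congrArg (fun t => t.2.2) h
  rw [pullback_cls, cls_eq_zero_iff] at h1 h2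
  refine ⟨h1, h2, fun p q => sub_eq_zero.1 ?_⟩
  rw [← nu_cls_tmul φ ψ hc, h3]
  rfl

/-- The identity is the only common point, and there both primitives take the value `f(1,1)`, so
gluing applies. -/
lemma theta_injective (φ : P →* X) (ψ : Q →* X) (hc : ∀ p q, Commute (φ p) (ψ q))
    (hsurj : ∀ x, ∃ p q, φ p * ψ q = x) (hφ : Function.Injective φ) (hψ : Function.Injective ψ)
    (hdisj : ∀ p q, φ p = ψ q → φ p = 1) : Function.Injective (theta φ ψ hc D) := by
  refine (injective_iff_map_eq_zero _).2 fun η hη => ?_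
  obtain ⟨f, rfl⟩ := cls_surjective η
  obtain ⟨⟨a, ha⟩, ⟨b, hb⟩, hf⟩ := theta_cls_eq_zero hη
  refine cls_eq_zero_of_glue f φ ψ hc hsurj a b ha hb hf fun p q h => ?_
  have hp : p = 1 := hφ ((hdisj p q h).trans (map_one φ).symm)
  have hq : q = 1 := hψ ((h.symm.trans (hdisj p q h)).trans (map_one ψ).symm)
  subst hp hq
  have h1 := ha 1 1
  have h2 := hb 1 1
  simp only [map_one, mul_one, sub_self, zero_add] at h1 h2
  exact h1.symm.trans h2

/-- The cocycle `f₁(p, p') + f₂(q, q') + β(p ⊗ q')` on `P × Q`, where `p` and `q` denote the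
components of an element. -/
def prodZ2 (π₁ : X →* P) (π₂ : X →* Q) (f₁ : Z2 P D) (f₂ : Z2 Q D) (β : AbTensor P Q →+ D) :
    Z2 X D :=
  mkZ2 (fun x y => val f₁ (π₁ x) (π₁ y) + val f₂ (π₂ x) (π₂ y) +
      β (Additive.ofMul (Abelianization.of (π₁ x)) ⊗ₜ Additive.ofMul (Abelianization.of (π₂ y))))
    fun x y z => by
      have h1 := eq_sub_of_add_eq (val_cocycle f₁ (π₁ x) (π₁ y) (π₁ z))
      have h2 := eq_sub_of_add_eq (val_cocycle f₂ (π₂ x) (π₂ y) (π₂ z))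
      simp only [map_mul, ofMul_mul, TensorProduct.add_tmul, TensorProduct.tmul_add, map_add, h1,
        h2]
      abel

/-- The class of `prodZ2` is a preimage. Antisymmetrising it cancels the `f₁` and `f₂` terms,
because `f(x,1) = f(1,x)`, and leaves `β`. -/
lemma theta_surjective (φ : P →* X) (ψ : Q →* X) (hc : ∀ p q, Commute (φ p) (ψ q))
    (π₁ : X →* P) (π₂ : X →* Q) (h₁φ : ∀ p, π₁ (φ p) = p) (h₁ψ : ∀ q, π₁ (ψ q) = 1)
    (h₂φ : ∀ p, π₂ (φ p) = 1) (h₂ψ : ∀ q, π₂ (ψ q) = q) :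
    Function.Surjective (theta φ ψ hc D) := by
  rintro ⟨ξ₁, ξ₂, β⟩
  obtain ⟨f₁, rfl⟩ := cls_surjective ξ₁
  obtain ⟨f₂, rfl⟩ := cls_surjective ξ₂
  have hval : ∀ x y, val (prodZ2 π₁ π₂ f₁ f₂ β) x y = val f₁ (π₁ x) (π₁ y) +
      val f₂ (π₂ x) (π₂ y) + β (Additive.ofMul (Abelianization.of (π₁ x)) ⊗ₜ
        Additive.ofMul (Abelianization.of (π₂ y))) := fun _ _ => rfl
  refine ⟨cls X D (prodZ2 π₁ π₂ f₁ f₂ β), Prod.ext ?_ (Prod.ext ?_ ?_)⟩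
  · change pullback D φ _ = cls P D f₁
    rw [pullback_cls, cls_eq_cls_iff]
    -- The coboundary of a constant cochain is that constant; it absorbs the unnormalised `f₂(1,1)`.
    refine ⟨fun _ => val f₂ 1 1, fun p p' => ?_⟩
    change val (prodZ2 π₁ π₂ f₁ f₂ β) (φ p) (φ p') = _
    rw [hval]
    simp [h₁φ, h₂φ]
  · change pullback D ψ _ = cls Q D f₂
    rw [pullback_cls, cls_eq_cls_iff]
    refine ⟨fun _ => val f₁ 1 1, fun q q' => ?_⟩
    change val (prodZ2 π₁ π₂ f₁ f₂ β) (ψ q) (ψ q') = _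
    rw [hval]
    simp [h₁ψ, h₂ψ, add_comm]
  · change nu φ ψ hc _ = β
    refine abTensor_hom_ext fun p q => ?_
    rw [nu_cls_tmul, hval, hval]
    simp [h₁φ, h₂φ, h₁ψ, h₂ψ, val_one_left _ p, val_one_right _ p, val_one_left _ q,
      val_one_right _ q]

end directProduct

/-! ### Properties of the transgression -/

section transgressionProperties

variable {X Y D : Type u} [Group X] [Group Y] [AddCommGroup D] (N : Subgroup X) [N.Normal]

/-- The component in `N` of an element of `X`, for the section of `X → X/N` used in `factorSet`. -/
def fiberPart (x : X) : N :=
  ⟨x * (x : X ⧸ N).out⁻¹, by rw [← QuotientGroup.eq_one_iff]; simp⟩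

lemma coe_fiberPart (x : X) : (fiberPart N x : X) = x * (x : X ⧸ N).out⁻¹ := rfl

lemma coe_factorSet (x y : X ⧸ N) : (factorSet N x y : X) = x.out * y.out * (x * y).out⁻¹ := rfl

lemma fiberPart_mul (hN : N ≤ Subgroup.center X) (x y : X) :
    fiberPart N (x * y)
      = fiberPart N x * fiberPart N y * factorSet N (x : X ⧸ N) (y : X ⧸ N) := by
  have hc : (fiberPart N y : X) * (x : X ⧸ N).out = (x : X ⧸ N).out * fiberPart N y :=
    (Subgroup.mem_center_iff.1 (hN (fiberPart N y).2) _).symm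
  apply Subtype.ext
  simp only [Subgroup.coe_mul, coe_factorSet]
  rw [show (fiberPart N x : X) * fiberPart N y * ((x : X ⧸ N).out * (y : X ⧸ N).out *
      ((x : X ⧸ N) * (y : X ⧸ N)).out⁻¹) = fiberPart N x * (fiberPart N y * (x : X ⧸ N).out) *
      ((y : X ⧸ N).out * ((x : X ⧸ N) * (y : X ⧸ N)).out⁻¹) by group, hc]
  simp only [coe_fiberPart, QuotientGroup.mk_mul]
  group

lemma fiberPart_coe (n : N) (x : X) : fiberPart N (n * x) = n * fiberPart N x := by
  apply Subtype.ext
  have h : ((n * x : X) : X ⧸ N) = x := by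
    rw [QuotientGroup.mk_mul, (QuotientGroup.eq_one_iff (n : X)).2 n.2, one_mul]
  rw [coe_fiberPart, h, mul_assoc]
  rfl

/-- The cocycle representing `traFull N hN F`. -/
def traZ2 (hN : N ≤ Subgroup.center X) (F : Additive N →+ D) : Z2 (X ⧸ N) D :=
  mkZ2 (fun x y => F (Additive.ofMul (factorSet N x y))) fun x y z => by
    simp only [← map_add, ← ofMul_mul, factorSet_cocycle N hN]

lemma traFull_eq_cls (hN : N ≤ Subgroup.center X) (F : Additive N →+ D) :
    traFull N hN F = cls (X ⧸ N) D (traZ2 N hN F) := rfl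

lemma val_traZ2 (hN : N ≤ Subgroup.center X) (F : Additive N →+ D) (x y : X ⧸ N) :
    val (traZ2 N hN F) x y = F (Additive.ofMul (factorSet N x y)) := rfl

/-- Inflated to `X`, the transgression cocycle is the coboundary of `-F ∘ fiberPart`. -/
lemma val_traZ2_coe (hN : N ≤ Subgroup.center X) (F : Additive N →+ D) (x y : X) :
    val (traZ2 N hN F) (x : X ⧸ N) (y : X ⧸ N) = F (Additive.ofMul (fiberPart N (x * y)))
      - F (Additive.ofMul (fiberPart N x)) - F (Additive.ofMul (fiberPart N y)) := by
  rw [fiberPart_mul N hN, ofMul_mul, ofMul_mul, map_add, map_add, val_traZ2]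
  abel

lemma pullback_traFull_eq_zero (hN : N ≤ Subgroup.center X) (F : Additive N →+ D) :
    pullback D (QuotientGroup.mk' N) (traFull N hN F) = 0 := by
  rw [traFull_eq_cls, pullback_cls, cls_eq_zero_iff]
  refine ⟨fun x => -F (Additive.ofMul (fiberPart N x)), fun x y => ?_⟩
  refine (val_traZ2_coe N hN F x y).trans ?_
  simp only [sub_neg_eq_add]
  abel

/-- A class of `X/N` that vanishes on `X` is a transgression. -/
lemma exists_traFull_of_pullback_eq_zero (hN : N ≤ Subgroup.center X) (η : H2 (X ⧸ N) D)
    (hη : pullback D (QuotientGroup.mk' N) η = 0) : ∃ F : Additive N →+ D, traFull N hN F = η := by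
  obtain ⟨f, rfl⟩ := cls_surjective η
  rw [pullback_cls, cls_eq_zero_iff] at hη
  obtain ⟨c, hc⟩ := hη
  have hc' : ∀ x y : X, val f (x : X ⧸ N) (y : X ⧸ N) = c y - c (x * y) + c x := hc
  -- `n` is trivial in `X/N` and `f(1,y) = f(1,1)`, so `c` is additive along `N` up to a constant;
  -- `F` below corrects for that constant.
  have hn : ∀ (n : N) (y : X), c (n * y) = c n + c y - val f 1 1 := fun n y => by
    have h := hc' n y
    rw [(QuotientGroup.eq_one_iff (n : X)).2 n.2, val_one_left] at h
    rw [h]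
    abel
  let F : Additive N →+ D := AddMonoidHom.mk' (fun n => val f 1 1 - c (n.toMul : X)) fun n m => by
    rw [toMul_add, Subgroup.coe_mul, hn]
    abel
  refine ⟨F, (cls_eq_cls_iff (traZ2 N hN F) f).2 ⟨fun x => -c x.out, fun x y => ?_⟩⟩
  rw [val_traZ2]
  have h1 := hc' x.out y.out
  have h2 := hn (factorSet N x y) (x * y).out
  rw [coe_factorSet, inv_mul_cancel_right] at h2
  rw [QuotientGroup.out_eq', QuotientGroup.out_eq', h2] at h1
  change val f 1 1 - c (factorSet N x y : X) = _
  rw [h1, coe_factorSet]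
  simp only [sub_neg_eq_add]
  abel

/-- If the transgression of `F` vanishes then so does `F` on `N ∩ X'`. -/
lemma eq_zero_of_traFull_eq_zero (hN : N ≤ Subgroup.center X) (F : Additive N →+ D)
    (hF : traFull N hN F = 0) (n : N) (hn : (n : X) ∈ commutator X) :
    F (Additive.ofMul n) = 0 := by
  rw [traFull_eq_cls, cls_eq_zero_iff] at hF
  obtain ⟨c, hc⟩ := hF
  -- Both `-F ∘ fiberPart` and `c` have the inflated cocycle as coboundary, so their difference is a
  -- homomorphism on `X` and kills `X'`.
  let e : X →* Multiplicative D := MonoidHom.mk'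
    (fun x => Multiplicative.ofAdd (F (Additive.ofMul (fiberPart N x)) + c x)) fun x y => by
      have h := hc x y
      rw [val_traZ2_coe, sub_sub, sub_eq_iff_eq_add] at h
      rw [← ofAdd_add, h, QuotientGroup.mk_mul]
      congr 1
      abel
  have he : ∀ x, (e x).toAdd = F (Additive.ofMul (fiberPart N x)) + c x := fun _ => rfl
  have h1 : (e 1).toAdd = 0 := by rw [map_one]; rfl
  have h2 : (e n).toAdd = 0 := by
    have : (n : X) ∈ e.ker := Abelianization.commutator_subset_ker e hn
    rw [MonoidHom.mem_ker.1 this]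
    rfl
  -- The representative of the trivial coset need not be `1`; the resulting term is removed using `e
  -- 1 = 0`.
  have h3 := fiberPart_coe N n 1
  rw [mul_one] at h3
  rw [he, h3, (QuotientGroup.eq_one_iff (n : X)).2 n.2, ofMul_mul, map_add, add_assoc] at h2
  rw [he, QuotientGroup.mk_one] at h1
  rwa [h1, add_zero] at h2

/-- Naturality of transgression. The cochain measures how far `φ` of a representative in `X` is from
the chosen representative in `Y`. -/
lemma pullback_map_traFull (M : Subgroup Y) [M.Normal] (hN : N ≤ Subgroup.center X)
    (hM : M ≤ Subgroup.center Y) (φ : X →* Y) (h : N ≤ M.comap φ) (ρ : N →* M)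
    (hρ : ∀ n : N, (ρ n : Y) = φ n) (F : Additive M →+ D) :
    pullback D (QuotientGroup.map N M φ h) (traFull M hM F)
      = traFull N hN (F.comp (MonoidHom.toAdditive ρ)) := by
  rw [traFull_eq_cls, traFull_eq_cls, pullback_cls, cls_eq_cls_iff]
  refine ⟨fun x => -F (Additive.ofMul (fiberPart M (φ x.out))), fun x y => ?_⟩
  have hx : ∀ x : X ⧸ N, ((φ x.out : Y) : Y ⧸ M) = QuotientGroup.map N M φ h x := fun x => by
    conv_rhs => rw [← QuotientGroup.out_eq' x]
    rfl
  change val (traZ2 M hM F) (QuotientGroup.map N M φ h x) (QuotientGroup.map N M φ h y) = _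
  rw [← hx, ← hx, val_traZ2_coe, val_traZ2]
  have hk : φ x.out * φ y.out = ρ (factorSet N x y) * φ (x * y).out := by
    rw [hρ, coe_factorSet, ← map_mul, ← map_mul, inv_mul_cancel_right]
  rw [hk, fiberPart_coe, ofMul_mul, map_add]
  change _ = F (Additive.ofMul (ρ (factorSet N x y))) + _
  simp only [sub_neg_eq_add]
  abel

end transgressionProperties

/-- A homomorphism to a divisible group that vanishes on the kernel of a homomorphism `i` to a
commutative group extends along `i`. -/
lemma exists_extension {B C D : Type u} [Group B] [Group C] [AddCommGroup D] [DivisibleBy D ℤ]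
    (hC : ∀ x y : C, x * y = y * x) (i : B →* C) (d : Additive B →+ D)
    (hd : ∀ b, i b = 1 → d (Additive.ofMul b) = 0) :
    ∃ e : Additive C →+ D, ∀ b, e (Additive.ofMul (i b)) = d (Additive.ofMul b) := by
  let _ : CommGroup C := { (inferInstance : Group C) with mul_comm := hC }
  let j : Additive B →+ Additive C := MonoidHom.toAdditive i
  let d' : j.range →+ D := AddMonoidHom.liftOfSurjective j.rangeRestrict
    j.rangeRestrict_surjective ⟨d, fun b hb => hd b.toMul (congrArg Subtype.val hb)⟩
  have hd' : ∀ b, d' (j.rangeRestrict b) = d b := fun b =>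
    AddMonoidHom.liftOfRightInverse_comp_apply _ _ _ _ b
  obtain ⟨e, he⟩ := Module.Baer.extension_property_addMonoidHom (Module.Baer.of_divisible D)
    j.range.subtype Subtype.val_injective d'
  exact ⟨e, fun b => (DFunLike.congr_fun he (j.rangeRestrict (Additive.ofMul b))).trans (hd' _)⟩

/-! ### The exact sequence of a central product -/

section exactSequence

variable {G D : Type u} [Group G] [AddCommGroup D] {H K : Subgroup G} [H.Normal] [K.Normal]

/-! ### `G/A` as the direct product of `H/A` and `K/A`. -/

omit [K.Normal] in
lemma exists_mul_eq (hHK : H ⊔ K = ⊤) (g : G) : ∃ (h : H) (k : K), (h : G) * k = g := by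
  have hg : g ∈ H ⊔ K := hHK ▸ Subgroup.mem_top g
  obtain ⟨h, hh, k, hk, e⟩ := Subgroup.mem_sup_of_normal_left.1 hg
  exact ⟨⟨h, hh⟩, ⟨k, hk⟩, e⟩

omit [K.Normal] in
lemma amalgam_le_center (hHK : H ⊔ K = ⊤) (hcomm : ⁅H, K⁆ = ⊥) :
    H ⊓ K ≤ Subgroup.center G := fun a ha => Subgroup.mem_center_iff.2 fun g => by
  obtain ⟨h, k, rfl⟩ := exists_mul_eq hHK g
  have h1 : Commute (h : G) a := commute_of_commutator_eq_bot hcomm h ⟨a, ha.2⟩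
  have h2 : Commute a (k : G) := commute_of_commutator_eq_bot hcomm ⟨a, ha.1⟩ k
  exact (h1.mul_left h2.symm).eq

lemma quotLeft_injective : Function.Injective (quotLeft H K) :=
  (injective_iff_map_eq_one _).2 fun x hx => by
    obtain ⟨h, rfl⟩ := QuotientGroup.mk_surjective x
    exact (QuotientGroup.eq_one_iff h).2
      (Subgroup.mem_subgroupOf.2 ((QuotientGroup.eq_one_iff (h : G)).1 hx))

lemma quotRight_injective : Function.Injective (quotRight H K) :=
  (injective_iff_map_eq_one _).2 fun x hx => by
    obtain ⟨k, rfl⟩ := QuotientGroup.mk_surjective x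
    exact (QuotientGroup.eq_one_iff k).2
      (Subgroup.mem_subgroupOf.2 ((QuotientGroup.eq_one_iff (k : G)).1 hx))

lemma quotLeft_eq_one_of_eq (x : H ⧸ (H ⊓ K).subgroupOf H) (y : K ⧸ (H ⊓ K).subgroupOf K)
    (hxy : quotLeft H K x = quotRight H K y) : quotLeft H K x = 1 := by
  obtain ⟨h, rfl⟩ := QuotientGroup.mk_surjective x
  obtain ⟨k, rfl⟩ := QuotientGroup.mk_surjective y
  have hm : (h : G)⁻¹ * k ∈ H ⊓ K := QuotientGroup.eq.1 hxy
  refine (QuotientGroup.eq_one_iff (h : G)).2 ⟨h.2, ?_⟩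
  have := K.mul_mem k.2 (K.inv_mem hm.2)
  simpa using this

lemma exists_quot_mul_eq (hHK : H ⊔ K = ⊤) (x : G ⧸ (H ⊓ K)) :
    ∃ p q, quotLeft H K p * quotRight H K q = x := by
  obtain ⟨g, rfl⟩ := QuotientGroup.mk_surjective x
  obtain ⟨h, k, rfl⟩ := exists_mul_eq hHK g
  exact ⟨QuotientGroup.mk h, QuotientGroup.mk k, rfl⟩

lemma thetaBar_bijective (hHK : H ⊔ K = ⊤) (hcomm : ⁅H, K⁆ = ⊥) :
    Function.Bijective (thetaBar D hcomm) := by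
  refine ⟨theta_injective _ _ _ (exists_quot_mul_eq hHK) quotLeft_injective quotRight_injective
    quotLeft_eq_one_of_eq, ?_⟩
  let m := MonoidHom.noncommCoprod (quotLeft H K) (quotRight H K) (quot_commute hcomm)
  have hm : Function.Bijective m := by
    refine ⟨(injective_iff_map_eq_one _).2 ?_, fun x => ?_⟩
    · rintro ⟨p, q⟩ h
      have h' : quotLeft H K p * quotRight H K q = 1 := h
      have h1 := quotLeft_eq_one_of_eq p q⁻¹
        (by rw [map_inv]; exact eq_inv_of_mul_eq_one_left h')
      rw [h1, one_mul] at h'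
      exact Prod.ext (quotLeft_injective (h1.trans (map_one _).symm))
        (quotRight_injective (h'.trans (map_one _).symm))
    · obtain ⟨p, q, h⟩ := exists_quot_mul_eq hHK x
      exact ⟨(p, q), h⟩
  let e := MulEquiv.ofBijective m hm
  have h1 : ∀ p, e.symm (quotLeft H K p) = (p, 1) := fun p => by
    rw [MulEquiv.symm_apply_eq]
    change _ = quotLeft H K p * quotRight H K 1
    rw [map_one, mul_one]
  have h2 : ∀ q, e.symm (quotRight H K q) = (1, q) := fun q => by
    rw [MulEquiv.symm_apply_eq]
    change _ = quotLeft H K 1 * quotRight H K q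
    rw [map_one, one_mul]
  exact theta_surjective _ _ _ ((MonoidHom.fst _ _).comp e.symm.toMonoidHom)
    ((MonoidHom.snd _ _).comp e.symm.toMonoidHom) (fun p => congrArg Prod.fst (h1 p))
    (fun q => congrArg Prod.fst (h2 q)) (fun p => congrArg Prod.snd (h1 p))
    (fun q => congrArg Prod.snd (h2 q))

/-! ### Transgression from `A`, inflation, and the kernel of `θ'`. -/

variable (H K) in
/-- The identification of `A`, as a subgroup of `H`, with `A`. -/
def amalgamLeft : (H ⊓ K).subgroupOf H →* ↥(H ⊓ K) :=
  MonoidHom.mk' (fun a => ⟨a, Subgroup.mem_subgroupOf.1 a.2⟩) fun _ _ => rfl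

variable (H K) in
/-- The identification of `A`, as a subgroup of `K`, with `A`. -/
def amalgamRight : (H ⊓ K).subgroupOf K →* ↥(H ⊓ K) :=
  MonoidHom.mk' (fun a => ⟨a, Subgroup.mem_subgroupOf.1 a.2⟩) fun _ _ => rfl

omit [H.Normal] [K.Normal] in
lemma out_mem_of_eq_coe (L : Subgroup G) (hL : H ⊓ K ≤ L) (l : L) {x : G ⧸ (H ⊓ K)}
    (hx : ((l : G) : G ⧸ (H ⊓ K)) = x) : x.out ∈ L := by
  have h : (l : G)⁻¹ * x.out ∈ H ⊓ K :=
    QuotientGroup.eq.1 (hx.trans (QuotientGroup.out_eq' x).symm)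
  simpa using L.mul_mem l.2 (hL h)

/-- The first two components are naturality. The third vanishes because representatives of cosets
from `H/A` and `K/A` lie in `H` and `K`, hence commute. -/
lemma thetaBar_traFull (hHK : H ⊔ K = ⊤) (hcomm : ⁅H, K⁆ = ⊥) (F : Additive ↥(H ⊓ K) →+ D) :
    thetaBar D hcomm (traFull _ (amalgam_le_center hHK hcomm) F) =
      (traFull _ (amalgam_le_center_left hcomm) (F.comp (MonoidHom.toAdditive (amalgamLeft H K))),
       traFull _ (amalgam_le_center_right hcomm)
        (F.comp (MonoidHom.toAdditive (amalgamRight H K))), 0) := by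
  refine Prod.ext ?_ (Prod.ext ?_ ?_)
  · exact pullback_map_traFull _ _ _ _ _ _ _ (fun _ => rfl) F
  · exact pullback_map_traFull _ _ _ _ _ _ _ (fun _ => rfl) F
  · refine abTensor_hom_ext fun p q => ?_
    refine (nu_cls_tmul _ _ _ (traZ2 _ (amalgam_le_center hHK hcomm) F) p q).trans ?_
    rw [val_traZ2, val_traZ2, AddMonoidHom.zero_apply, sub_eq_zero]
    congr 2
    apply Subtype.ext
    rw [coe_factorSet, coe_factorSet, (quot_commute hcomm p q).eq]
    congr 1
    obtain ⟨h, rfl⟩ := QuotientGroup.mk_surjective p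
    obtain ⟨k, rfl⟩ := QuotientGroup.mk_surjective q
    exact commute_of_commutator_eq_bot hcomm
      ⟨_, out_mem_of_eq_coe H inf_le_left h rfl⟩ ⟨_, out_mem_of_eq_coe K inf_le_right k rfl⟩

lemma thetaPrime_inf {hcomm : ⁅H, K⁆ = ⊥} {η : H2 (G ⧸ (H ⊓ K)) D}
    {ξ₁ : H2 (H ⧸ (H ⊓ K).subgroupOf H) D} {ξ₂ : H2 (K ⧸ (H ⊓ K).subgroupOf K) D}
    (hη : thetaBar D hcomm η = (ξ₁, ξ₂, 0)) :
    thetaPrime D hcomm (pullback D (QuotientGroup.mk' (H ⊓ K)) η) =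
      (pullback D (QuotientGroup.mk' _) ξ₁, pullback D (QuotientGroup.mk' _) ξ₂, 0) := by
  have h1 : pullback D (quotLeft H K) η = ξ₁ := congrArg Prod.fst hη
  have h2 : pullback D (quotRight H K) η = ξ₂ := congrArg (fun t => t.2.1) hη
  have h3 : nu (quotLeft H K) (quotRight H K) (quot_commute hcomm) η = 0 :=
    congrArg (fun t => t.2.2) hη
  refine Prod.ext ?_ (Prod.ext ?_ ?_)
  · change pullback D H.subtype _ = pullback D _ ξ₁
    rw [← h1, pullback_pullback, pullback_pullback]
    rfl
  · change pullback D K.subtype _ = pullback D _ ξ₂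
    rw [← h2, pullback_pullback, pullback_pullback]
    rfl
  · change nu _ _ _ _ = 0
    refine abTensor_hom_ext fun p q => ?_
    obtain ⟨f, rfl⟩ := cls_surjective η
    have h := DFunLike.congr_fun h3 (Additive.ofMul (Abelianization.of (QuotientGroup.mk p)) ⊗ₜ
      Additive.ofMul (Abelianization.of (QuotientGroup.mk q)))
    rw [nu_cls_tmul] at h
    rw [pullback_cls]
    exact (nu_cls_tmul _ _ _ _ p q).trans h

/-- A class killed by `θ'` is inflated from a class whose image under `θ` is a transgression in the
first coordinate. -/
lemma exists_inf_of_thetaPrime_eq_zero (hHK : H ⊔ K = ⊤) (hcomm : ⁅H, K⁆ = ⊥) (ξ : H2 G D)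
    (hξ : thetaPrime D hcomm ξ = 0) :
    ∃ (F : Additive ((H ⊓ K).subgroupOf H) →+ D) (η : H2 (G ⧸ (H ⊓ K)) D),
      thetaBar D hcomm η = (traFull _ (amalgam_le_center_left hcomm) F, 0, 0) ∧
      pullback D (QuotientGroup.mk' (H ⊓ K)) η = ξ := by
  obtain ⟨f, rfl⟩ := cls_surjective ξ
  obtain ⟨⟨a, ha⟩, ⟨b, hb⟩, hf⟩ := theta_cls_eq_zero hξ
  let ι : (H ⊓ K).subgroupOf H → K := fun z => ⟨z, (Subgroup.mem_subgroupOf.1 z.2).2⟩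
  -- Two primitives of the same cocycle on `A` differ by a homomorphism.
  let F : Additive ((H ⊓ K).subgroupOf H) →+ D :=
    AddMonoidHom.mk' (fun z => b (ι z.toMul) - a z.toMul) fun z w => by
      have h := (ha z.toMul w.toMul).symm.trans (hb (ι z.toMul) (ι w.toMul))
      have e : ι (z + w).toMul = ι z.toMul * ι w.toMul := rfl
      rw [toMul_add, ← toMul_add, e, toMul_add, Subgroup.coe_mul]
      have h' : b (ι z.toMul * ι w.toMul) = b (ι w.toMul) + b (ι z.toMul)
          - (a w.toMul - a (z.toMul * w.toMul) + a z.toMul) := by rw [h]; abel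
      rw [h']
      abel
  have hF : ∀ z, F (Additive.ofMul z) = b (ι z) - a z := fun _ => rfl
  obtain ⟨η, hη⟩ := (thetaBar_bijective (D := D) hHK hcomm).2
    (traFull _ (amalgam_le_center_left hcomm) F, 0, 0)
  refine ⟨F, η, hη, ?_⟩
  obtain ⟨e, rfl⟩ := cls_surjective η
  have h1 : pullback D (quotLeft H K) (cls _ D e)
      = cls _ D (traZ2 _ (amalgam_le_center_left hcomm) F) := congrArg Prod.fst hη
  have h2 : pullback D (quotRight H K) (cls _ D e) = 0 := congrArg (fun t => t.2.1) hη
  have h3 : nu (quotLeft H K) (quotRight H K) (quot_commute hcomm) (cls _ D e) = 0 :=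
    congrArg (fun t => t.2.2) hη
  rw [pullback_cls, cls_eq_cls_iff] at h1
  rw [pullback_cls, cls_eq_zero_iff] at h2
  obtain ⟨c₁, hc₁⟩ := h1
  obtain ⟨c₂, hc₂⟩ := h2
  let e' := pullbackZ2 (QuotientGroup.mk' (H ⊓ K)) e
  have he₁ : ∀ p p' : H, val e' p p' =
      val (traZ2 _ (amalgam_le_center_left hcomm) F) (QuotientGroup.mk p) (QuotientGroup.mk p') +
      (c₁ (QuotientGroup.mk p') - c₁ (QuotientGroup.mk (p * p')) + c₁ (QuotientGroup.mk p)) :=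
    fun p p' => hc₁ (QuotientGroup.mk p) (QuotientGroup.mk p')
  have he₂ : ∀ q q' : K, val e' q q' =
      c₂ (QuotientGroup.mk q') - c₂ (QuotientGroup.mk (q * q')) + c₂ (QuotientGroup.mk q) :=
    fun q q' => hc₂ (QuotientGroup.mk q) (QuotientGroup.mk q')
  have he : ∀ (p : H) (q : K), val e' p q = val e' q p := fun p q => by
    have h := DFunLike.congr_fun h3 (Additive.ofMul (Abelianization.of (QuotientGroup.mk p)) ⊗ₜ
      Additive.ofMul (Abelianization.of (QuotientGroup.mk q)))
    rw [nu_cls_tmul] at h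
    exact sub_eq_zero.1 h
  rw [pullback_cls, ← sub_eq_zero, ← map_sub]
  have hsub : ∀ x y, val (e' - f) x y = val e' x y - val f x y := fun _ _ => rfl
  -- On `H` the transgression cocycle is the coboundary of `-P`. On `A` the function `P` is `b - a`
  -- plus a constant, so it turns the `-a` of the first primitive into `-b`.
  let P : H → D := fun p => F (Additive.ofMul (fiberPart ((H ⊓ K).subgroupOf H) p))
  refine cls_eq_zero_of_glue (e' - f) H.subtype K.subtype (commute_of_commutator_eq_bot hcomm)
    (exists_mul_eq hHK) (fun p => c₁ (QuotientGroup.mk p) - P p - a p)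
    (fun q => c₂ (QuotientGroup.mk q) - b q) (fun p p' => ?_) (fun q q' => ?_) (fun p q => ?_)
    fun p q hpq => ?_
  · rw [hsub, ha]
    change val e' p p' - _ = _
    rw [he₁, val_traZ2_coe]
    abel
  · rw [hsub, hb]
    change val e' q q' - _ = _
    rw [he₂]
    abel
  · rw [hsub, hsub, hf]
    exact congrArg (· - _) (he p q)
  · have hpq' : (p : G) = q := hpq
    have hpK : (p : G) ∈ K := hpq' ▸ q.2
    obtain ⟨z, rfl⟩ : ∃ z : (H ⊓ K).subgroupOf H, (z : H) = p :=
      ⟨⟨p, Subgroup.mem_subgroupOf.2 ⟨p.2, hpK⟩⟩, rfl⟩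
    obtain rfl : ι z = q := Subtype.ext hpq'
    have hz : (QuotientGroup.mk (z : H) : H ⧸ (H ⊓ K).subgroupOf H) = 1 :=
      (QuotientGroup.eq_one_iff _).2 z.2
    have hιz : (QuotientGroup.mk (ι z) : K ⧸ (H ⊓ K).subgroupOf K) = 1 :=
      (QuotientGroup.eq_one_iff _).2 (Subgroup.mem_subgroupOf.2 z.2)
    have hP : P z = b (ι z) - a z + P 1 := by
      have h := fiberPart_coe ((H ⊓ K).subgroupOf H) z 1
      rw [mul_one] at h
      change F _ = _
      rw [h, ofMul_mul, map_add, hF]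
    -- Both sides equal the value of `e'` at `(1,1)`; this matches the remaining constants.
    have hone : c₁ 1 - P 1 = c₂ 1 := by
      have h4 := he₁ 1 1
      have h5 := he₂ 1 1
      rw [val_traZ2_coe] at h4
      simp only [mul_one, sub_self, zero_add, QuotientGroup.mk_one, OneMemClass.coe_one] at h4 h5
      rw [← h5, h4]
      change _ = 0 - P 1 + c₁ 1
      abel
    change c₁ (QuotientGroup.mk (z : H)) - P z - a z = c₂ (QuotientGroup.mk (ι z)) - b (ι z)
    rw [hz, hιz, hP, ← hone]
    abel

/-! ### Existence, uniqueness and kernel of the values of `χ`. -/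

variable [DivisibleBy D ℤ]

lemma IsChiValue.add {hcomm : ⁅H, K⁆ = ⊥} {f f' : Additive ↥(⁅H, H⁆ ⊓ ⁅K, K⁆) →+ D} {ξ ξ' : H2 G D}
    (h : IsChiValue hcomm f ξ) (h' : IsChiValue hcomm f' ξ') :
    IsChiValue hcomm (f + f') (ξ + ξ') := by
  obtain ⟨g₁, g₂, η, rfl, hη, rfl⟩ := h
  obtain ⟨g₁', g₂', η', rfl, hη', rfl⟩ := h'
  refine ⟨g₁ + g₁', g₂ + g₂', η + η', ?_, ?_, map_add _ _ _⟩
  · ext z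
    exact add_sub_add_comm _ _ _ _
  · rw [map_add, hη, hη', map_add, map_add]
    simp

lemma IsChiValue.neg {hcomm : ⁅H, K⁆ = ⊥} {f : Additive ↥(⁅H, H⁆ ⊓ ⁅K, K⁆) →+ D} {ξ : H2 G D}
    (h : IsChiValue hcomm f ξ) : IsChiValue hcomm (-f) (-ξ) := by
  obtain ⟨g₁, g₂, η, rfl, hη, rfl⟩ := h
  refine ⟨-g₁, -g₂, -η, ?_, ?_, map_neg _ _⟩
  · ext z
    exact neg_sub_neg _ _ |>.trans (neg_sub _ _).symm
  · rw [map_neg, hη, map_neg, map_neg]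
    simp

omit [H.Normal] [K.Normal] [DivisibleBy D ℤ] in
lemma alphaStar_apply (g₁ : Additive ↥((H ⊓ K).subgroupOf H ⊓ commutator H) →+ D)
    (g₂ : Additive ↥((H ⊓ K).subgroupOf K ⊓ commutator K) →+ D) (z : ↥(⁅H, H⁆ ⊓ ⁅K, K⁆)) :
    alphaStar H K g₁ g₂ (Additive.ofMul z)
      = g₁ (Additive.ofMul (inclLeft H K z)) - g₂ (Additive.ofMul (inclRight H K z)) := rfl

/-- Divisibility extends `f` from `Z` to `A ∩ H'`, so `g₂ = 0` suffices. -/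
lemma exists_isChiValue (hHK : H ⊔ K = ⊤) (hcomm : ⁅H, K⁆ = ⊥)
    (f : Additive ↥(⁅H, H⁆ ⊓ ⁅K, K⁆) →+ D) : ∃ ξ, IsChiValue hcomm f ξ := by
  obtain ⟨g, hg⟩ := exists_extension (D := D)
    (fun x y : ↥((H ⊓ K).subgroupOf H ⊓ commutator H) => Subtype.ext
      (Subgroup.mem_center_iff.1 (amalgam_le_center_left hcomm y.2.1) x)) (inclLeft H K) f
    fun z hz => by
      have : z = 1 := Subtype.ext (congrArg
        (fun t : ↥((H ⊓ K).subgroupOf H ⊓ commutator H) => ((t : H) : G)) hz)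
      rw [this, ofMul_one, map_zero]
  obtain ⟨η, hη⟩ := (thetaBar_bijective (D := D) hHK hcomm).2
    (tra _ D (amalgam_le_center_left hcomm) g, tra _ D (amalgam_le_center_right hcomm) 0, 0)
  refine ⟨_, g, 0, η, ?_, hη, rfl⟩
  refine DFunLike.ext _ _ fun z => ?_
  exact (sub_zero _).trans (hg z.toMul)

/-- The kernel of multiplication `(A ∩ H') × (A ∩ K') → A` consists of the pairs `(z, z⁻¹)` with `z
∈ Z`. As `g₁ = g₂` on `Z`, the pair extends to one `F` on `A`; then `η = tra F`, which inflates to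
zero. -/
lemma IsChiValue.eq_zero (hHK : H ⊔ K = ⊤) {hcomm : ⁅H, K⁆ = ⊥} {ξ : H2 G D}
    (h : IsChiValue hcomm 0 ξ) : ξ = 0 := by
  obtain ⟨g₁, g₂, η, hg, hη, rfl⟩ := h
  have hA := amalgam_le_center hHK hcomm
  have hAc : ∀ x y : ↥(H ⊓ K), x * y = y * x := fun x y =>
    Subtype.ext (Subgroup.mem_center_iff.1 (hA y.2) x)
  let i₁ := (amalgamLeft H K).comp (Subgroup.inclusion
    (inf_le_left : (H ⊓ K).subgroupOf H ⊓ commutator H ≤ _))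
  let i₂ := (amalgamRight H K).comp (Subgroup.inclusion
    (inf_le_left : (H ⊓ K).subgroupOf K ⊓ commutator K ≤ _))
  let d := MonoidHom.toAdditiveLeft (MonoidHom.coprod (AddMonoidHom.toMultiplicativeRight g₁)
    (AddMonoidHom.toMultiplicativeRight g₂))
  have hd : ∀ x y, d (Additive.ofMul (x, y)) = g₁ (Additive.ofMul x) + g₂ (Additive.ofMul y) :=
    fun _ _ => rfl
  obtain ⟨F, hF⟩ := exists_extension hAc
    (MonoidHom.noncommCoprod i₁ i₂ fun x y => hAc (i₁ x) (i₂ y)) d fun ⟨x, y⟩ hxy => by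
      have hxy' : i₁ x * i₂ y = 1 := hxy
      have hxG : ((x : H) : G) = ((y : K) : G)⁻¹ :=
        congrArg Subtype.val (eq_inv_of_mul_eq_one_left hxy')
      have h1 : ((x : H) : G) ∈ ⁅H, H⁆ := by
        rw [← Subgroup.map_subtype_commutator]
        exact ⟨x, x.2.2, rfl⟩
      have h2 : ((x : H) : G) ∈ ⁅K, K⁆ := by
        rw [hxG, ← Subgroup.map_subtype_commutator]
        exact inv_mem ⟨y, y.2.2, rfl⟩
      have e1 : inclLeft H K ⟨(x : H), h1, h2⟩ = x := rfl
      have e2 : inclRight H K ⟨(x : H), h1, h2⟩ = y⁻¹ := Subtype.ext (Subtype.ext hxG)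
      have h := DFunLike.congr_fun hg (Additive.ofMul ⟨(x : H), h1, h2⟩)
      rw [alphaStar_apply, e1, e2, ofMul_inv, map_neg, sub_neg_eq_add] at h
      exact (hd x y).trans h
  have hF₁ : resHom D inf_le_left (F.comp (MonoidHom.toAdditive (amalgamLeft H K))) = g₁ := by
    refine DFunLike.ext _ _ fun x => ?_
    refine Eq.trans ?_ ((hF (x.toMul, 1)).trans (hd _ _) |>.trans (by simp))
    change F (Additive.ofMul (i₁ x.toMul)) = F (Additive.ofMul (i₁ x.toMul * i₂ 1))
    rw [map_one, mul_one]
  have hF₂ : resHom D inf_le_left (F.comp (MonoidHom.toAdditive (amalgamRight H K))) = g₂ := by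
    refine DFunLike.ext _ _ fun y => ?_
    refine Eq.trans ?_ ((hF (1, y.toMul)).trans (hd _ _) |>.trans (by simp))
    change F (Additive.ofMul (i₂ y.toMul)) = F (Additive.ofMul (i₁ 1 * i₂ y.toMul))
    rw [map_one, one_mul]
  have : η = traFull _ hA F := (thetaBar_bijective hHK hcomm).1 (by
    rw [hη, thetaBar_traFull hHK hcomm, ← hF₁, ← hF₂, tra_resHom, tra_resHom])
  rw [this, pullback_traFull_eq_zero]

lemma IsChiValue.unique (hHK : H ⊔ K = ⊤) {hcomm : ⁅H, K⁆ = ⊥}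
    {f : Additive ↥(⁅H, H⁆ ⊓ ⁅K, K⁆) →+ D} {ξ ξ' : H2 G D} (h : IsChiValue hcomm f ξ)
    (h' : IsChiValue hcomm f ξ') : ξ = ξ' := by
  have h0 := h.add h'.neg
  rw [add_neg_cancel] at h0
  exact add_neg_eq_zero.1 (h0.eq_zero hHK)

/-- This is injectivity of `tra`, in the form needed for comparing with a homomorphism on all of
`N`. -/
lemma eq_of_tra_eq {X : Type u} [Group X] (N : Subgroup X) [N.Normal]
    (hN : N ≤ Subgroup.center X) (g : Additive ↥(N ⊓ commutator X) →+ D) (F : Additive N →+ D)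
    (h : traFull N hN F = tra N D hN g) : resHom D inf_le_left F = g := by
  obtain ⟨E, rfl⟩ := resHom_surjective N hN g
  rw [tra_resHom, ← sub_eq_zero, ← map_sub] at h
  rw [← sub_eq_zero, ← map_sub]
  refine DFunLike.ext _ _ fun n => ?_
  exact eq_zero_of_traFull_eq_zero N hN _ h ⟨n.toMul, n.toMul.2.1⟩ n.toMul.2.2

/-- If `η` inflates to zero it is the transgression of some `F` on `A`, so `g₁` and `g₂` are both
restrictions of `F` and cancel on `Z`. -/
lemma IsChiValue.eq_zero_of_zero (hHK : H ⊔ K = ⊤) {hcomm : ⁅H, K⁆ = ⊥}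
    {f : Additive ↥(⁅H, H⁆ ⊓ ⁅K, K⁆) →+ D} (h : IsChiValue hcomm f (0 : H2 G D)) : f = 0 := by
  obtain ⟨g₁, g₂, η, rfl, hη, h0⟩ := h
  obtain ⟨F, rfl⟩ := exists_traFull_of_pullback_eq_zero _ (amalgam_le_center hHK hcomm) η h0
  rw [thetaBar_traFull hHK hcomm] at hη
  rw [← eq_of_tra_eq _ _ g₁ _ (congrArg Prod.fst hη),
    ← eq_of_tra_eq _ _ g₂ _ (congrArg (fun t => t.2.1) hη)]
  ext z
  exact sub_self _

lemma pullback_tra_eq_zero {X : Type u} [Group X] (N : Subgroup X) [N.Normal]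
    (hN : N ≤ Subgroup.center X) (g : Additive ↥(N ⊓ commutator X) →+ D) :
    pullback D (QuotientGroup.mk' N) (tra N D hN g) = 0 := by
  obtain ⟨E, rfl⟩ := resHom_surjective N hN g
  rw [tra_resHom, pullback_traFull_eq_zero]

lemma thetaPrime_eq_zero_iff (hHK : H ⊔ K = ⊤) (hcomm : ⁅H, K⁆ = ⊥) (ξ : H2 G D) :
    thetaPrime D hcomm ξ = 0 ↔ ∃ f, IsChiValue hcomm f ξ := by
  constructor
  · intro h
    obtain ⟨F, η, hη, hξ⟩ := exists_inf_of_thetaPrime_eq_zero hHK hcomm ξ h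
    -- The preimage under `χ` is the mismatch `F` restricted to `Z`.
    refine ⟨_, resHom D inf_le_left F, 0, η, rfl, ?_, hξ⟩
    rw [hη, tra_resHom, map_zero]
  · rintro ⟨f, g₁, g₂, η, rfl, hη, rfl⟩
    rw [thetaPrime_inf hη, pullback_tra_eq_zero, pullback_tra_eq_zero]
    rfl

/-- The homomorphism `χ : Hom(Z, D) → H²(G, D)`. -/
def chi (hHK : H ⊔ K = ⊤) (hcomm : ⁅H, K⁆ = ⊥) :
    (Additive ↥(⁅H, H⁆ ⊓ ⁅K, K⁆) →+ D) →+ H2 G D :=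
  -- Values are chosen arbitrarily; additivity follows from their uniqueness.
  AddMonoidHom.mk' (fun f => (exists_isChiValue hHK hcomm f).choose) fun f f' =>
    (exists_isChiValue hHK hcomm (f + f')).choose_spec.unique hHK
      ((exists_isChiValue hHK hcomm f).choose_spec.add
        (exists_isChiValue hHK hcomm f').choose_spec)

lemma chi_eq_iff (hHK : H ⊔ K = ⊤) (hcomm : ⁅H, K⁆ = ⊥) (f : Additive ↥(⁅H, H⁆ ⊓ ⁅K, K⁆) →+ D)
    (ξ : H2 G D) : chi hHK hcomm f = ξ ↔ IsChiValue hcomm f ξ := by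
  have h : IsChiValue hcomm f (chi hHK hcomm f) := (exists_isChiValue hHK hcomm f).choose_spec
  exact ⟨fun e => e ▸ h, fun h' => h.unique hHK h'⟩

lemma chi_injective (hHK : H ⊔ K = ⊤) (hcomm : ⁅H, K⁆ = ⊥) :
    Function.Injective (chi (D := D) hHK hcomm) :=
  (injective_iff_map_eq_zero _).2 fun f hf => ((chi_eq_iff hHK hcomm f 0).1 hf).eq_zero_of_zero hHK

lemma exact_chi_thetaPrime (hHK : H ⊔ K = ⊤) (hcomm : ⁅H, K⁆ = ⊥) :
    Function.Exact (chi (D := D) hHK hcomm) (thetaPrime D hcomm) := fun ξ => by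
  rw [thetaPrime_eq_zero_iff hHK]
  exact exists_congr fun f => (chi_eq_iff hHK hcomm f ξ).symm

end exactSequence

end

end CentralProduct

theorem mainTheorem4 {G D : Type u} [Group G] [AddCommGroup D] [DivisibleBy D ℤ]
    (H K : Subgroup G) [H.Normal] [K.Normal] (hHK : H ⊔ K = ⊤) (hcomm : ⁅H, K⁆ = ⊥) :
    Function.Bijective (CentralProduct.thetaBar D hcomm) ∧
    (∃ χ : (Additive ↥(⁅H, H⁆ ⊓ ⁅K, K⁆) →+ D) →+ CentralProduct.H2 G D,
      (∀ f ξ, χ f = ξ ↔ CentralProduct.IsChiValue hcomm f ξ) ∧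
      Function.Injective χ ∧
      Function.Exact χ (CentralProduct.thetaPrime D hcomm)) ∧
    (⁅H, H⁆ ⊓ ⁅K, K⁆ = ⊥ → Function.Injective (CentralProduct.thetaPrime D hcomm)) := by
  refine ⟨CentralProduct.thetaBar_bijective hHK hcomm, ⟨CentralProduct.chi hHK hcomm,
    CentralProduct.chi_eq_iff hHK hcomm, CentralProduct.chi_injective hHK hcomm,
    CentralProduct.exact_chi_thetaPrime hHK hcomm⟩, fun hZ => ?_⟩
  refine (injective_iff_map_eq_zero _).2 fun ξ hξ => ?_
  obtain ⟨f, rfl⟩ := (CentralProduct.exact_chi_thetaPrime hHK hcomm ξ).1 hξ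
  have hf : f = 0 := by
    refine DFunLike.ext _ _ fun z => ?_
    have hz : z = 0 := Subtype.ext (Subgroup.mem_bot.1 (hZ.le z.toMul.2))
    rw [hz, map_zero, map_zero]
  rw [hf, map_zero]
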